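/- Let $\Sigma=(G,\sigma)$ be a finite simple plane signed graph, i.e. a finite simple graph $G$ drawn in the plane without crossings, with edge signs $\sigma:E(G)\to\{+1,-1\}$. The sign of a circle (cycle) is the product of the signs of its edges. A vertex is \emph{exterior} in a plane graph if it is incident with the unbounded (outer) face, and the \emph{outer circle} of a plane graph is the boundary of the outer face when this is a circle of the graph. A vertex is \emph{inside} a closed walk if it lies in a bounded component of the complement of the curve drawn by the walk. Let $k,\ell,t\ge 1$ and let $v_1,v_2,v_3,v_4,\;p'_1,\dots,p'_k,\;q'_1,\dots,q'_\ell,\;r_1,\dots,r_t$ be distinct vertices of $G$ (for $t=1$ there is a single vertex $r_1=r_t$). Assume: (a) The outer circle of $\Sigma$ is $$C_{\mathrm{out}}=v_1v_2q'_1q'_2\cdots q'_\ell v_3v_4p'_kp'_{k-1}\cdots p'_1v_1 .$$ (b) $\Sigma$ contains the hexagon $H=v_1v_2r_tv_3v_4r_1v_1$ (a closed walk consisting of two triangles if $t=1$) and the path $R=r_1r_2\cdots r_t$; the vertices $r_2,\dots,r_{t-1}$ are inside $H$, and every vertex inside $H$ lies on $R$. In particular $\Sigma$ contains the circles $$C'_L=v_1r_1v_4p'_kp'_{k-1}\cdots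 p'_1v_1,\qquad C'_R=v_2q'_1q'_2\cdots q'_\ell v_3r_tv_2 .$$ (c) (Left release.) There are a set $E_L\subseteq E(G)$ and a vertex sequence $p_1,\dots,p_m$ with $p_1=p'_1$ and $p_m=p'_k$ such that $\Sigma-E_L$ is $2$-connected, every vertex inside $C'_L$ is exterior in $\Sigma-E_L$, the graph $\Sigma-E_L$ contains the circle $C_L=v_1r_1v_4p_mp_{m-1}\cdots p_1v_1$ (so $p_1v_1,\ v_1r_1,\ r_1v_4,\ v_4p_m\notin E_L$), and $p_1p_2\cdots p_m$ is the new outer-face path replacing $p'_1p'_2\cdots p'_k$, i.e. the outer circle of $\Sigma-E_L$ is $$v_1v_2q'_1\cdots q'_\ell v_3v_4p_mp_{m-1}\cdots p_1v_1 .$$ (d) (Right release.) There are a set $E_R\subseteq E(G)$ and a vertex sequence $q_1,\dots,q_n$ with $q_1=q'_1$ and $q_n=q'_\ell$ such that $\Sigma-E_R$ is $2$-connected, every vertex inside $C'_R$ is exterior in $\Sigma-E_R$, the graph $\Sigma-E_R$ contains the circle $C_R=v_2q_1q_2\cdots q_nv_3r_tv_2$, and the outer circle of $\Sigma-E_R$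 is $$v_1v_2q_1\cdots q_nv_3v_4p'_kp'_{k-1}\cdots p'_1v_1 .$$ Let $C_1=v_1v_2r_tr_{t-1}\cdots r_1v_1$ and $C_2=v_3v_4r_1r_2\cdots r_tv_3$. Then $$H_1=v_1v_2q_1\cdots q_nv_3r_tr_{t-1}\cdots r_1v_4p_mp_{m-1}\cdots p_1v_1,$$ $$H_2=v_1r_1r_2\cdots r_tv_2q_1\cdots q_nv_3v_4p_mp_{m-1}\cdots p_1v_1$$ are Hamiltonian circles of $\Sigma$ and $$\frac{\sigma(H_1)}{\sigma(H_2)}=\frac{\sigma(C_2)}{\sigma(C_1)} .$$ Consequently, if $\sigma(C_1)\ne\sigma(C_2)$, then $\Sigma$ contains both a positive and a negative Hamiltonian circle. -/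

import Mathlib

/-- The edges of the closed walk `a₀ a₁ … aₙ₋₁ a₀` whose cyclic vertex sequence is
`l = [a₀, …, aₙ₋₁]`. -/
def cycEdges {V : Type*} (l : List V) : List (Sym2 V) :=
  List.zipWith (fun a b => s(a, b)) l (l.rotate 1)

/-- `l = [a₀, …, aₙ₋₁]` is the cyclic vertex sequence of a closed walk `a₀ a₁ … aₙ₋₁ a₀` of `G`. -/
def IsClosedWalk {V : Type*} (G : SimpleGraph V) (l : List V) : Prop :=
  ∀ e ∈ cycEdges l, e ∈ G.edgeSet

/-- `l = [a₀, …, aₙ₋₁]` is the cyclic vertex sequence of a circle (simple cycle) of `G`. -/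
def IsCircle {V : Type*} (G : SimpleGraph V) (l : List V) : Prop :=
  3 ≤ l.length ∧ l.Nodup ∧ IsClosedWalk G l

/-- Sign of the closed walk with cyclic vertex sequence `l`: the product of its edge signs. -/
def cycSign {V : Type*} (σ : Sym2 V → ℤˣ) (l : List V) : ℤˣ :=
  ((cycEdges l).map σ).prod

/-- Sign of a walk: the product of its edge signs. -/
def walkSign {V : Type*} {G : SimpleGraph V} (σ : Sym2 V → ℤˣ) {u v : V} (w : G.Walk u v) : ℤˣ :=
  (w.edges.map σ).prod

/-- `2`-connected: at least three vertices, connected, and without a cut vertex. -/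
def TwoConnected {V : Type*} (G : SimpleGraph V) : Prop :=
  3 ≤ Nat.card V ∧ G.Connected ∧ ∀ v : V, (G.induce {v}ᶜ).Connected

/-- The points outside a compact plane set `X`: the unbounded connected component of `Xᶜ`. -/
def outsideOf (X : Set ℂ) : Set ℂ :=
  {z | z ∉ X ∧ ¬ Bornology.IsBounded (connectedComponentIn Xᶜ z)}

/-- The points strictly inside a compact plane set `X` (such as a closed curve): the union of
the bounded connected components of `Xᶜ`. -/
def insideOf (X : Set ℂ) : Set ℂ :=
  {z | z ∉ X ∧ Bornology.IsBounded (connectedComponentIn Xᶜ z)}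

/-- A plane drawing of the simple graph `G` in the Euclidean plane (written `ℂ`): vertices are
distinct points, the edge `uv` is a Jordan arc joining the points `u` and `v`, an edge contains no
vertices except its ends, and two edges meet only in common ends.  Values of `arc` at pairs
that are not edges are irrelevant. -/
structure PlaneDrawing {V : Type*} (G : SimpleGraph V) where
  pt : V → ℂ
  arc : Sym2 V → Set ℂ
  pt_injective : Function.Injective pt
  arc_eq : ∀ u v : V, G.Adj u v →
    ∃ γ : Path (pt u) (pt v), Function.Injective γ ∧ Set.range γ = arc s(u, v)
  mem_of_pt_mem : ∀ e ∈ G.edgeSet, ∀ w : V, pt w ∈ arc e → w ∈ e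
  arc_inter : ∀ e ∈ G.edgeSet, ∀ f ∈ G.edgeSet, e ≠ f → ∀ z ∈ arc e ∩ arc f,
    ∃ w : V, w ∈ e ∧ w ∈ f ∧ z = pt w

namespace PlaneDrawing

variable {V : Type*} {G : SimpleGraph V}

/-- The point set of a spanning subgraph `G'` of `G`, drawn as in `D`. -/
def pointSet (D : PlaneDrawing G) (G' : SimpleGraph V) : Set ℂ :=
  Set.range D.pt ∪ ⋃ e ∈ G'.edgeSet, D.arc e

/-- The outer (unbounded) face of the spanning subgraph `G'` of `G`. -/
def outerFace (D : PlaneDrawing G) (G' : SimpleGraph V) : Set ℂ :=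
  outsideOf (D.pointSet G')

/-- `w` is an exterior vertex of `G'`: it is incident with the outer face of `G'`. -/
def IsExterior (D : PlaneDrawing G) (G' : SimpleGraph V) (w : V) : Prop :=
  D.pt w ∈ frontier (D.outerFace G')

/-- The plane curve formed by the closed walk with cyclic vertex sequence `l`. -/
def curve (D : PlaneDrawing G) (l : List V) : Set ℂ :=
  ⋃ e ∈ cycEdges l, D.arc e

/-- The vertex `w` lies strictly inside the closed walk `l`. -/
def Inside (D : PlaneDrawing G) (l : List V) (w : V) : Prop :=
  D.pt w ∈ insideOf (D.curve l)

/-- `l` is the outer boundary circle of `G'`: a circle of `G'` that is the boundary of the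
outer face of `G'`. -/
def IsOuterCircle (D : PlaneDrawing G) (G' : SimpleGraph V) (l : List V) : Prop :=
  IsCircle G' l ∧ frontier (D.outerFace G') = D.curve l

/-- Release condition for a set `E` of edges of `G` and a circle `C'`: deleting `E` keeps the graph
`2`-connected and makes every vertex strictly inside `C'` exterior; the graph `G - E` contains the
circle `C` (in particular no edge of `C` is deleted), and its outer boundary circle is `O`. -/
structure Release (D : PlaneDrawing G) (E : Set (Sym2 V)) (C' C O : List V) : Prop where
  subset : E ⊆ G.edgeSet
  twoConnected : TwoConnected (G.deleteEdges E)
  released : ∀ w : V, D.Inside C' w → D.IsExterior (G.deleteEdges E) w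
  circle : IsCircle (G.deleteEdges E) C
  outer : D.IsOuterCircle (G.deleteEdges E) O

end PlaneDrawing

open Complex in
/-- `z ↦ z - x` has a continuous logarithm on `X`. -/
def HasLog (X : Set ℂ) (x : ℂ) : Prop :=
  ∃ g : ℂ → ℂ, ContinuousOn g X ∧ ∀ z ∈ X, exp (g z) = z - x

/-- Two continuous logarithms of the same function on a preconnected set differ by a constant. -/
theorem IsPreconnected.exists_log_eq_add {α : Type*} [TopologicalSpace α] {S : Set α}
    (hS : IsPreconnected S) {g h : α → ℂ} (hg : ContinuousOn g S) (hh : ContinuousOn h S)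
    (H : ∀ z ∈ S, Complex.exp (g z) = Complex.exp (h z)) :
    ∃ c, Complex.exp c = 1 ∧ ∀ z ∈ S, g z = h z + c := by
  rcases S.eq_empty_or_nonempty with rfl | ⟨a, ha⟩
  · exact ⟨0, by simp, by simp⟩
  let f : α → ℝ := fun z => ((g z - h z) / (2 * Real.pi * Complex.I)).re
  have hI : (2 * Real.pi * Complex.I : ℂ) ≠ 0 := Complex.two_pi_I_ne_zero
  have hf : ContinuousOn f S :=
    Complex.continuous_re.comp_continuousOn ((hg.sub hh).div_const _)
  have key : ∀ z ∈ S, ∃ n : ℤ, f z = n ∧ g z = h z + n * (2 * Real.pi * Complex.I) := by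
    intro z hz
    obtain ⟨n, hn⟩ := Complex.exp_eq_exp_iff_exists_int.1 (H z hz)
    refine ⟨n, ?_, hn⟩
    simp only [f, hn, add_sub_cancel_left, mul_div_cancel_right₀ _ hI, Complex.intCast_re]
  have hdisc : IsDiscrete (Set.range ((↑) : ℤ → ℝ)) :=
    ⟨Int.isClosedEmbedding_coe_real.isEmbedding.toHomeomorph.symm.isEmbedding.discreteTopology⟩
  have hconst : ∀ z ∈ S, f z = f a := fun z hz =>
    hS.constant_of_mapsTo hdisc hf
      (fun w hw => by obtain ⟨n, hn, -⟩ := key w hw; exact ⟨n, hn.symm⟩) hz ha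
  obtain ⟨n, hn, -⟩ := key a ha
  refine ⟨n * (2 * Real.pi * Complex.I), Complex.exp_int_mul_two_pi_mul_I n, fun z hz => ?_⟩
  obtain ⟨m, hm, hm'⟩ := key z hz
  have : (m : ℝ) = n := by rw [← hm, ← hn, hconst z hz]
  rw [hm', Int.cast_injective this]

theorem HasLog.mono {X Y : Set ℂ} {x : ℂ} (h : HasLog Y x) (hXY : X ⊆ Y) : HasLog X x :=
  let ⟨g, hg, he⟩ := h
  ⟨g, hg.mono hXY, fun z hz => he z (hXY hz)⟩

/-- A form of Janiszewski's theorem. -/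
theorem HasLog.union {A B : Set ℂ} {x : ℂ} (hA : HasLog A x) (hB : HasLog B x)
    (cA : IsClosed A) (cB : IsClosed B) (hAB : IsPreconnected (A ∩ B)) : HasLog (A ∪ B) x := by
  obtain ⟨g, hg, eg⟩ := hA
  obtain ⟨h, hh, eh⟩ := hB
  obtain ⟨c, hc, hgh⟩ := hAB.exists_log_eq_add (hg.mono Set.inter_subset_left)
    (hh.mono Set.inter_subset_right) (fun z hz => by rw [eg z hz.1, eh z hz.2])
  classical
  have e1 : Set.EqOn (A.piecewise g (fun z => h z + c)) g A := fun z hz => by simp [hz]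
  have e2 : Set.EqOn (A.piecewise g (fun z => h z + c)) (fun z => h z + c) B := fun z hz => by
    by_cases hzA : z ∈ A
    · simpa [hzA] using hgh z ⟨hzA, hz⟩
    · simp [hzA]
  refine ⟨A.piecewise g (fun z => h z + c), ?_, ?_⟩
  · exact (hg.congr e1).union_of_isClosed ((hh.add continuousOn_const).congr e2) cA cB
  · rintro z (hz | hz)
    · rw [e1 hz, eg z hz]
    · rw [e2 hz, Complex.exp_add, hc, mul_one, eh z hz]

theorem HasLog.of_norm_sub_lt {X : Set ℂ} {x y : ℂ} (h : HasLog X x)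
    (hxy : ∀ z ∈ X, ‖x - y‖ < ‖z - x‖) : HasLog X y := by
  obtain ⟨g, hg, eg⟩ := h
  have hne : ∀ z ∈ X, z - x ≠ 0 := fun z hz =>
    norm_pos_iff.1 ((norm_nonneg _).trans_lt (hxy z hz))
  have hs : ∀ z ∈ X, 1 + (x - y) / (z - x) ∈ Complex.slitPlane := fun z hz =>
    Complex.mem_slitPlane_of_norm_lt_one (by
      rw [norm_div, div_lt_one (norm_pos_iff.2 (hne z hz))]; exact hxy z hz)
  refine ⟨fun z => g z + Complex.log (1 + (x - y) / (z - x)), hg.add (ContinuousOn.clog ?_ hs), ?_⟩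
  · exact continuousOn_const.add (continuousOn_const.div (by fun_prop) hne)
  · intro z hz
    rw [Complex.exp_add, eg z hz, Complex.exp_log (Complex.slitPlane_ne_zero (hs z hz))]
    field_simp [hne z hz]
    ring

theorem HasLog.of_isPreconnected {X S : Set ℂ} {x y : ℂ} (h : HasLog X x) (hX : IsClosed X)
    (hS : IsPreconnected S) (hSX : Disjoint S X) (hx : x ∈ S) (hy : y ∈ S) : HasLog X y := by
  have key : ∀ a ∉ X, ∃ ε > 0, ∀ b ∈ Metric.ball a ε, b ∉ X ∧ (HasLog X a ↔ HasLog X b) := by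
    intro a ha
    obtain ⟨δ, hδ, hb⟩ := Metric.isOpen_iff.1 hX.isOpen_compl a ha
    have hd : ∀ z ∈ X, δ ≤ ‖z - a‖ := fun z hz => by
      by_contra! hlt
      exact hb (by simpa [Metric.mem_ball, dist_eq_norm] using hlt) hz
    refine ⟨δ / 2, by positivity, fun b hb' => ?_⟩
    have hab : ‖a - b‖ < δ / 2 := by
      rw [Metric.mem_ball, dist_comm, dist_eq_norm] at hb'; exact hb'
    refine ⟨hb (Metric.ball_subset_ball (by linarith) hb'), fun h => h.of_norm_sub_lt fun z hz => ?_,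
      fun h => h.of_norm_sub_lt fun z hz => ?_⟩
    · linarith [hd z hz]
    · have : ‖z - a‖ ≤ ‖z - b‖ + ‖a - b‖ := by
        rw [norm_sub_rev a b]; simpa using norm_add_le (z - b) (b - a)
      rw [norm_sub_rev]
      linarith [hd z hz]
  by_contra hny
  have hu : IsOpen {a | a ∉ X ∧ HasLog X a} := Metric.isOpen_iff.2 fun a ha => by
    obtain ⟨ε, hε, h'⟩ := key a ha.1
    exact ⟨ε, hε, fun b hb => ⟨(h' b hb).1, (h' b hb).2.1 ha.2⟩⟩
  have hv : IsOpen {a | a ∉ X ∧ ¬ HasLog X a} := Metric.isOpen_iff.2 fun a ha => by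
    obtain ⟨ε, hε, h'⟩ := key a ha.1
    exact ⟨ε, hε, fun b hb => ⟨(h' b hb).1, fun hb' => ha.2 ((h' b hb).2.2 hb')⟩⟩
  have hnot : ∀ {a}, a ∈ S → a ∉ X := fun ha => Set.disjoint_left.1 hSX ha
  obtain ⟨z, -, hz1, hz2⟩ := hS _ _ hu hv
    (fun a ha => by by_cases hl : HasLog X a; exacts [.inl ⟨hnot ha, hl⟩, .inr ⟨hnot ha, hl⟩])
    ⟨x, hx, hnot hx, h⟩ ⟨y, hy, hnot hy, hny⟩
  exact hz2.2 hz1.2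

theorem hasLog_of_norm_lt {X : Set ℂ} {x : ℂ} (h : ∀ z ∈ X, ‖z‖ < ‖x‖) : HasLog X x := by
  rcases eq_or_ne x 0 with rfl | hx
  · refine ⟨fun _ => 0, continuousOn_const, fun z hz => ?_⟩
    exact absurd (h z hz) (by simp)
  have hs : ∀ z ∈ X, 1 + -(z / x) ∈ Complex.slitPlane := fun z hz =>
    Complex.mem_slitPlane_of_norm_lt_one (by
      rw [norm_neg, norm_div, div_lt_one (norm_pos_iff.2 hx)]; exact h z hz)
  refine ⟨fun z => Complex.log (-x) + Complex.log (1 + -(z / x)),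
    continuousOn_const.add (ContinuousOn.clog (by fun_prop) hs), fun z hz => ?_⟩
  rw [Complex.exp_add, Complex.exp_log (neg_ne_zero.2 hx),
    Complex.exp_log (Complex.slitPlane_ne_zero (hs z hz))]
  field_simp
  ring

theorem not_hasLog_sphere (x : ℂ) {R : ℝ} (hR : 0 < R) : ¬ HasLog (Metric.sphere x R) x := by
  rintro ⟨g, hg, eg⟩
  have hmem : ∀ θ : ℝ, x + Complex.exp (Real.log R + θ * Complex.I) ∈ Metric.sphere x R := by
    intro θ
    simp [Complex.norm_exp, Real.exp_log hR]
  have hcont : Continuous fun θ : ℝ => g (x + Complex.exp (Real.log R + θ * Complex.I)) :=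
    hg.comp_continuous (by fun_prop) hmem
  obtain ⟨c, -, hc⟩ := (isPreconnected_univ (α := ℝ)).exists_log_eq_add hcont.continuousOn
    (h := fun θ : ℝ => Real.log R + θ * Complex.I) (by fun_prop)
    (fun θ _ => by rw [eg _ (hmem θ)]; simp)
  have h0 := hc 0 trivial
  have h1 := hc (2 * Real.pi) trivial
  have he : Complex.exp (Real.log R + ((2 * Real.pi : ℝ) : ℂ) * Complex.I)
      = Complex.exp (Real.log R + ((0 : ℝ) : ℂ) * Complex.I) := by
    rw [Complex.exp_add, Complex.exp_add]
    push_cast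
    rw [Complex.exp_two_pi_mul_I]; simp
  simp only [he] at h1
  rw [h0] at h1
  have := Complex.two_pi_I_ne_zero
  push_cast at h1
  apply this
  linear_combination -h1

theorem exists_continuous_log {F : ℂ → ℂ} (hF : Continuous F) (h0 : ∀ z, F z ≠ 0) :
    ∃ L : ℂ → ℂ, Continuous L ∧ ∀ z, Complex.exp (L z) = F z := by
  obtain ⟨L, ⟨-, hL⟩, -⟩ := Complex.isCoveringMap_exp.existsUnique_continuousMap_lifts
    (f := ⟨fun z => (⟨F z, h0 z⟩ : {z : ℂ // z ≠ 0}), by fun_prop⟩) (0 : ℂ) (Complex.log (F 0))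
    (Subtype.ext (Complex.exp_log (h0 0)))
  exact ⟨L, L.continuous, fun z => congrArg Subtype.val (congrFun hL z)⟩

theorem frontier_connectedComponentIn_subset {X : Set ℂ} (hX : IsClosed X) (x : ℂ) :
    frontier (connectedComponentIn Xᶜ x) ⊆ X := by
  intro y hy
  by_contra hyX
  have hop : ∀ z, IsOpen (connectedComponentIn Xᶜ z) := fun z =>
    hX.isOpen_compl.connectedComponentIn
  have hyy : y ∈ connectedComponentIn Xᶜ y := mem_connectedComponentIn hyX
  obtain ⟨z, hz1, hz2⟩ := mem_closure_iff.1 hy.1 _ (hop y) hyy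
  rw [connectedComponentIn_eq hz1, ← connectedComponentIn_eq hz2] at hyy
  exact hy.2 ((hop x).interior_eq.symm ▸ hyy)

theorem HasLog.mem_outsideOf {X : Set ℂ} {x : ℂ} (h : HasLog X x) (hX : IsClosed X) :
    x ∈ outsideOf X := by
  obtain ⟨g, hg, eg⟩ := h
  have hx : x ∉ X := fun hx => Complex.exp_ne_zero _ ((eg x hx).trans (sub_self x))
  refine ⟨hx, fun hb => ?_⟩
  set W := connectedComponentIn Xᶜ x with hW
  have hxW : x ∈ W := mem_connectedComponentIn hx
  obtain ⟨G, hG⟩ := ContinuousMap.exists_restrict_eq hX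
    (⟨X.domRestrict g, hg.domRestrict⟩ : C(X, ℂ))
  have hGX : ∀ z ∈ X, G z = g z := fun z hz => congrArg (fun f : C(X, ℂ) => f ⟨z, hz⟩) hG
  classical
  let F : ℂ → ℂ := W.piecewise (fun z => Complex.exp (G z)) (fun z => z - x)
  have hF : Continuous F := by
    refine Continuous.piecewise (fun z hz => ?_) (by fun_prop) (by fun_prop)
    have hzX := frontier_connectedComponentIn_subset hX x hz
    rw [hGX z hzX, eg z hzX]
  have hF0 : ∀ z, F z ≠ 0 := by
    intro z
    by_cases hz : z ∈ W
    · simp [F, hz]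
    · simpa [F, hz, sub_eq_zero] using fun h : z = x => hz (h ▸ hxW)
  obtain ⟨L, hL, eL⟩ := exists_continuous_log hF hF0
  obtain ⟨R, hR0, hR⟩ := hb.subset_closedBall_lt 0 x
  refine not_hasLog_sphere x (R := R + 1) (by linarith) ⟨L, hL.continuousOn, fun z hz => ?_⟩
  have hzW : z ∉ W := fun hz' => by
    have h1 := hR hz'
    rw [Metric.mem_closedBall] at h1
    rw [Metric.mem_sphere] at hz
    linarith
  simp [eL, F, hzW]

theorem hasLog_of_mem_outsideOf {X : Set ℂ} {x : ℂ} (hX : IsCompact X) (h : x ∈ outsideOf X) :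
    HasLog X x := by
  obtain ⟨R, hR⟩ := hX.isBounded.subset_closedBall 0
  have : ∃ y ∈ connectedComponentIn Xᶜ x, R < ‖y‖ := by
    by_contra! hle
    exact h.2 ((Metric.isBounded_closedBall (x := (0 : ℂ)) (r := R)).subset fun y hy => by
      simpa using hle y hy)
  obtain ⟨y, hy, hRy⟩ := this
  refine (hasLog_of_norm_lt (X := X) (x := y) fun z hz => ?_).of_isPreconnected hX.isClosed
    isPreconnected_connectedComponentIn
    (Set.disjoint_left.2 fun z hz => connectedComponentIn_subset _ _ hz) hy
    (mem_connectedComponentIn h.1)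
  have := hR hz
  rw [mem_closedBall_zero_iff] at this
  linarith

theorem mem_outsideOf_iff {X : Set ℂ} {x : ℂ} (hX : IsCompact X) :
    x ∈ outsideOf X ↔ HasLog X x :=
  ⟨hasLog_of_mem_outsideOf hX, fun h => h.mem_outsideOf hX.isClosed⟩

theorem mem_insideOf_iff {X : Set ℂ} {x : ℂ} (hX : IsCompact X) :
    x ∈ insideOf X ↔ x ∉ X ∧ ¬ HasLog X x := by
  rw [← mem_outsideOf_iff hX, insideOf, outsideOf]
  simp only [Set.mem_ofPred_eq]
  tauto

theorem outsideOf_anti {X Y : Set ℂ} (hX : IsCompact X) (hY : IsCompact Y) (h : X ⊆ Y) :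
    outsideOf Y ⊆ outsideOf X := fun _ hx =>
  (mem_outsideOf_iff hX).2 (((mem_outsideOf_iff hY).1 hx).mono h)

theorem HasLog.notMem {X : Set ℂ} {x : ℂ} (h : HasLog X x) : x ∉ X :=
  fun hx => let ⟨_, _, eg⟩ := h
    Complex.exp_ne_zero _ ((eg x hx).trans (sub_self x))

/-- A point off `X` in the closure of the outside of `X` is outside `X`. -/
theorem hasLog_of_mem_closure {X : Set ℂ} {x : ℂ} (hX : IsCompact X) (hx : x ∉ X)
    (h : x ∈ closure (outsideOf X)) : HasLog X x := by
  obtain ⟨y, hy, hyo⟩ := mem_closure_iff.1 h _ (hX.isClosed.isOpen_compl.connectedComponentIn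
    (x := x)) (mem_connectedComponentIn hx)
  exact (hasLog_of_mem_outsideOf hX hyo).of_isPreconnected hX.isClosed
    isPreconnected_connectedComponentIn
    (Set.disjoint_left.2 fun z hz => connectedComponentIn_subset _ _ hz) hy
    (mem_connectedComponentIn hx)

theorem isOpen_outsideOf {X : Set ℂ} (hX : IsCompact X) : IsOpen (outsideOf X) := by
  refine isOpen_iff_forall_mem_open.2 fun x hx => ⟨connectedComponentIn Xᶜ x, fun y hy => ?_,
    hX.isClosed.isOpen_compl.connectedComponentIn, mem_connectedComponentIn hx.1⟩
  exact (mem_outsideOf_iff hX).2 ((hasLog_of_mem_outsideOf hX hx).of_isPreconnected hX.isClosed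
    isPreconnected_connectedComponentIn
    (Set.disjoint_left.2 fun z hz => connectedComponentIn_subset _ _ hz)
    (mem_connectedComponentIn hx.1) hy)

/-- If the boundary of the outside of `X` is `C ⊆ X`, every point outside `C` is outside `X`. -/
theorem hasLog_of_frontier_eq {X C : Set ℂ} (hX : IsCompact X) (hC : IsCompact C)
    (hf : frontier (outsideOf X) = C) {x : ℂ} (hx : HasLog C x) : HasLog X x := by
  have hxo := (mem_outsideOf_iff hC).2 hx
  set W := connectedComponentIn Cᶜ x
  obtain ⟨R, hR0, hR⟩ := hX.isBounded.subset_closedBall_lt 0 0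
  have : ∃ y ∈ W, R < ‖y‖ := by
    by_contra! hle
    exact hxo.2 ((Metric.isBounded_closedBall (x := (0 : ℂ)) (r := R)).subset fun y hy => by
      simpa using hle y hy)
  obtain ⟨y, hy, hRy⟩ := this
  have hyU : y ∈ outsideOf X := (mem_outsideOf_iff hX).2 (hasLog_of_norm_lt fun z hz => by
    have := hR hz
    rw [mem_closedBall_zero_iff] at this
    linarith)
  have hsub : W ⊆ outsideOf X := by
    refine isPreconnected_connectedComponentIn.subset_of_closure_inter_subset
      (isOpen_outsideOf hX) ⟨y, hy, hyU⟩ ?_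
    rintro z ⟨hz1, hz2⟩
    by_contra hz3
    have : z ∈ frontier (outsideOf X) := ⟨hz1, fun h => hz3 (interior_subset h)⟩
    exact connectedComponentIn_subset _ _ hz2 (hf ▸ this)
  exact (mem_outsideOf_iff hX).1 (hsub (mem_connectedComponentIn hx.notMem))

namespace PlaneDrawing

variable {V : Type*} {G : SimpleGraph V}

/-- The union of the arcs of the edges in `E`. -/
def edgePts (D : PlaneDrawing G) (E : Set (Sym2 V)) : Set ℂ := ⋃ e ∈ E, D.arc e

/-- The vertices incident with an edge in `E`. -/
def _root_.edgeVerts (E : Set (Sym2 V)) : Set V := {w | ∃ e ∈ E, w ∈ e}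

theorem mem_edgePts (D : PlaneDrawing G) {E : Set (Sym2 V)} {z : ℂ} :
    z ∈ D.edgePts E ↔ ∃ e ∈ E, z ∈ D.arc e := by simp [edgePts]

theorem edgePts_union (D : PlaneDrawing G) (E F : Set (Sym2 V)) :
    D.edgePts (E ∪ F) = D.edgePts E ∪ D.edgePts F := Set.biUnion_union _ _ _

theorem edgePts_mono (D : PlaneDrawing G) {E F : Set (Sym2 V)} (h : E ⊆ F) :
    D.edgePts E ⊆ D.edgePts F := Set.biUnion_subset_biUnion_left h

theorem pt_mem_arc (D : PlaneDrawing G) {e : Sym2 V} (he : e ∈ G.edgeSet) {w : V} (hw : w ∈ e) :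
    D.pt w ∈ D.arc e := by
  obtain ⟨u, rfl⟩ := hw
  obtain ⟨γ, -, hγ⟩ := D.arc_eq _ _ he
  exact hγ ▸ ⟨0, γ.source⟩

theorem pt_mem_edgePts (D : PlaneDrawing G) {E : Set (Sym2 V)} (hE : E ⊆ G.edgeSet) {w : V} :
    D.pt w ∈ D.edgePts E ↔ w ∈ edgeVerts E := by
  rw [mem_edgePts]
  exact exists_congr fun e => and_congr_right fun he =>
    ⟨D.mem_of_pt_mem e (hE he) w, D.pt_mem_arc (hE he)⟩

theorem isCompact_arc (D : PlaneDrawing G) {e : Sym2 V} (he : e ∈ G.edgeSet) :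
    IsCompact (D.arc e) := by
  induction e with | h u v =>
  obtain ⟨γ, -, hγ⟩ := D.arc_eq _ _ he
  exact hγ ▸ isCompact_range γ.continuous

theorem isPreconnected_arc (D : PlaneDrawing G) {e : Sym2 V} (he : e ∈ G.edgeSet) :
    IsPreconnected (D.arc e) := by
  induction e with | h u v =>
  obtain ⟨γ, -, hγ⟩ := D.arc_eq _ _ he
  exact hγ ▸ isPreconnected_range γ.continuous

theorem isPreconnected_arc_diff (D : PlaneDrawing G) {u v : V} (h : G.Adj u v) :
    IsPreconnected (D.arc s(u, v) \ {D.pt u}) := by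
  obtain ⟨γ, hi, hγ⟩ := D.arc_eq _ _ h
  have : D.arc s(u, v) \ {D.pt u} = γ '' Set.Ioi 0 := by
    ext z
    rw [← hγ]
    constructor
    · rintro ⟨⟨t, rfl⟩, ht⟩
      refine ⟨t, Set.mem_Ioi.2 (unitInterval.pos_iff_ne_zero.2 ?_), rfl⟩
      rintro rfl
      exact ht γ.source
    · rintro ⟨t, ht, rfl⟩
      refine ⟨⟨t, rfl⟩, fun hz => ?_⟩
      exact (Set.mem_Ioi.1 ht).ne' (hi (hz.trans γ.source.symm))
  rw [this]
  exact isPreconnected_Ioi.image _ γ.continuous.continuousOn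

theorem exists_mem_arc_ne (D : PlaneDrawing G) {u v : V} (h : G.Adj u v) :
    ∃ z ∈ D.arc s(u, v), z ≠ D.pt u ∧ z ≠ D.pt v := by
  obtain ⟨γ, hi, hγ⟩ := D.arc_eq _ _ h
  let t : unitInterval := ⟨1 / 2, by norm_num, by norm_num⟩
  refine ⟨γ t, hγ ▸ ⟨t, rfl⟩, fun hz => ?_, fun hz => ?_⟩
  · have := congrArg Subtype.val (hi (hz.trans γ.source.symm))
    norm_num [t] at this
  · have := congrArg Subtype.val (hi (hz.trans γ.target.symm))
    norm_num [t] at this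

theorem mem_edgePts_inter (D : PlaneDrawing G) {E F : Set (Sym2 V)} (hE : E ⊆ G.edgeSet)
    (hF : F ⊆ G.edgeSet) {z : ℂ} (hz : z ∈ D.edgePts E ∩ D.edgePts F) :
    z ∈ D.edgePts (E ∩ F) ∨ ∃ w ∈ edgeVerts E ∩ edgeVerts F, z = D.pt w := by
  obtain ⟨e, he, hze⟩ := D.mem_edgePts.1 hz.1
  obtain ⟨f, hf, hzf⟩ := D.mem_edgePts.1 hz.2
  by_cases hef : e = f
  · subst hef
    exact .inl (D.mem_edgePts.2 ⟨e, ⟨he, hf⟩, hze⟩)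
  · obtain ⟨w, hwe, hwf, rfl⟩ := D.arc_inter e (hE he) f (hF hf) hef z ⟨hze, hzf⟩
    exact .inr ⟨w, ⟨⟨e, he, hwe⟩, ⟨f, hf, hwf⟩⟩, rfl⟩

/-- Two drawn edge sets that share exactly a path of two edges meet in a connected set. -/
theorem isPreconnected_edgePts_inter (D : PlaneDrawing G) {E F : Set (Sym2 V)}
    (hE : E ⊆ G.edgeSet) (hF : F ⊆ G.edgeSet) {a b c : V}
    (habE : s(a, b) ∈ E) (hbcE : s(b, c) ∈ E) (habF : s(a, b) ∈ F) (hbcF : s(b, c) ∈ F)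
    (hac : s(a, c) ∉ E) (hV : ∀ w ∈ edgeVerts E, w ∈ edgeVerts F → w = a ∨ w = b ∨ w = c) :
    IsPreconnected (D.edgePts E ∩ D.edgePts F) := by
  have : D.edgePts E ∩ D.edgePts F = D.arc s(a, b) ∪ D.arc s(b, c) := by
    apply Set.Subset.antisymm
    · intro z hz
      rcases D.mem_edgePts_inter hE hF hz with h | ⟨w, ⟨hwE, hwF⟩, rfl⟩
      · obtain ⟨e, ⟨heE, heF⟩, hze⟩ := D.mem_edgePts.1 h
        induction e with | h x y =>
        have hxy : x ≠ y := (hE heE : G.Adj x y).ne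
        have hx := hV x ⟨_, heE, Sym2.mem_mk_left x y⟩ ⟨_, heF, Sym2.mem_mk_left x y⟩
        have hy := hV y ⟨_, heE, Sym2.mem_mk_right x y⟩ ⟨_, heF, Sym2.mem_mk_right x y⟩
        rcases hx with rfl | rfl | rfl <;> rcases hy with rfl | rfl | rfl <;>
          first
          | exact absurd rfl hxy
          | exact absurd heE hac
          | exact absurd (by rw [Sym2.eq_swap]; exact heE) hac
          | exact Or.inl hze
          | exact Or.inr hze
          | exact Or.inl (by rw [Sym2.eq_swap]; exact hze)
          | exact Or.inr (by rw [Sym2.eq_swap]; exact hze)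
      · rcases hV w hwE hwF with rfl | rfl | rfl
        · exact .inl (D.pt_mem_arc (hE habE) (Sym2.mem_mk_left _ _))
        · exact .inl (D.pt_mem_arc (hE habE) (Sym2.mem_mk_right _ _))
        · exact .inr (D.pt_mem_arc (hE hbcE) (Sym2.mem_mk_right _ _))
    · rintro z (hz | hz)
      · exact ⟨D.mem_edgePts.2 ⟨_, habE, hz⟩, D.mem_edgePts.2 ⟨_, habF, hz⟩⟩
      · exact ⟨D.mem_edgePts.2 ⟨_, hbcE, hz⟩, D.mem_edgePts.2 ⟨_, hbcF, hz⟩⟩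
  rw [this]
  exact (D.isPreconnected_arc (hE habE)).union (D.pt b)
    (D.pt_mem_arc (hE habE) (Sym2.mem_mk_right _ _))
    (D.pt_mem_arc (hE hbcE) (Sym2.mem_mk_left _ _)) (D.isPreconnected_arc (hE hbcE))

/-- Away from `u`, an edge `uw` avoids the edges not incident with `w`. -/
theorem disjoint_arc_diff (D : PlaneDrawing G) {E : Set (Sym2 V)} (hE : E ⊆ G.edgeSet) {u w : V}
    (h : G.Adj u w) (hw : w ∉ edgeVerts E) :
    Disjoint (D.arc s(u, w) \ {D.pt u}) (D.edgePts E) := by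
  refine Set.disjoint_left.2 fun z hz hzE => ?_
  obtain ⟨f, hf, hzf⟩ := D.mem_edgePts.1 hzE
  have hne : s(u, w) ≠ f := by
    rintro rfl
    exact hw ⟨_, hf, Sym2.mem_mk_right _ _⟩
  obtain ⟨x, hx, hxf, rfl⟩ := D.arc_inter _ h f (hE hf) hne z ⟨hz.1, hzf⟩
  rcases Sym2.mem_iff.1 hx with rfl | rfl
  · exact hz.2 rfl
  · exact hw ⟨f, hf, hxf⟩

theorem disjoint_arc (D : PlaneDrawing G) {E : Set (Sym2 V)} (hE : E ⊆ G.edgeSet) {u w : V}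
    (h : G.Adj u w) (hu : u ∉ edgeVerts E) (hw : w ∉ edgeVerts E) :
    Disjoint (D.arc s(u, w)) (D.edgePts E) := by
  refine Set.disjoint_left.2 fun z hz hzE => ?_
  by_cases hzu : z = D.pt u
  · exact hu ((D.pt_mem_edgePts hE).1 (hzu ▸ hzE))
  · exact Set.disjoint_left.1 (D.disjoint_arc_diff hE h hw) ⟨hz, hzu⟩ hzE

theorem edgePts_subset_pointSet (D : PlaneDrawing G) {E : Set (Sym2 V)} {G' : SimpleGraph V}
    (hE : E ⊆ G'.edgeSet) : D.edgePts E ⊆ D.pointSet G' :=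
  (D.edgePts_mono hE).trans Set.subset_union_right

theorem pt_mem_pointSet (D : PlaneDrawing G) (G' : SimpleGraph V) (w : V) :
    D.pt w ∈ D.pointSet G' := .inl ⟨w, rfl⟩

section Finite

variable [Finite V]

theorem isCompact_edgePts (D : PlaneDrawing G) {E : Set (Sym2 V)} (hE : E ⊆ G.edgeSet) :
    IsCompact (D.edgePts E) :=
  E.toFinite.isCompact_biUnion fun _ he => D.isCompact_arc (hE he)

theorem isCompact_pointSet (D : PlaneDrawing G) {G' : SimpleGraph V} (h : G' ≤ G) :
    IsCompact (D.pointSet G') :=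
  (Set.finite_range D.pt).isCompact.union
    (D.isCompact_edgePts (SimpleGraph.edgeSet_mono h))

/-- Exterior vertices stay exterior when edges are deleted. -/
theorem IsExterior.mono {D : PlaneDrawing G} {G' : SimpleGraph V} {w : V}
    (hw : D.IsExterior G w) (h : G' ≤ G) : D.IsExterior G' w := by
  refine ⟨closure_mono (outsideOf_anti (D.isCompact_pointSet h) (D.isCompact_pointSet le_rfl) ?_)
    hw.1, fun hi => (interior_subset hi : D.pt w ∈ D.outerFace G').1 (D.pt_mem_pointSet G' w)⟩
  exact Set.union_subset_union_right _ (D.edgePts_mono (SimpleGraph.edgeSet_mono h))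

/-- An exterior vertex is outside every drawn edge set that it is not on. -/
theorem IsExterior.hasLog {D : PlaneDrawing G} {w : V} (hw : D.IsExterior G w)
    {E : Set (Sym2 V)} (hE : E ⊆ G.edgeSet) (hwE : w ∉ edgeVerts E) :
    HasLog (D.edgePts E) (D.pt w) :=
  hasLog_of_mem_closure (D.isCompact_edgePts hE) (fun h => hwE ((D.pt_mem_edgePts hE).1 h))
    (closure_mono (outsideOf_anti (D.isCompact_edgePts hE) (D.isCompact_pointSet le_rfl)
      (D.edgePts_subset_pointSet hE)) hw.1)

theorem not_hasLog_of_outer_subset {D : PlaneDrawing G} {O E : Set (Sym2 V)}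
    (hE : E ⊆ G.edgeSet) (hOE : O ⊆ E)
    (hO : frontier (D.outerFace G) = D.edgePts O) {x : ℂ} (hx : x ∈ D.pointSet G) :
    ¬ HasLog (D.edgePts E) x := fun h =>
  (hasLog_of_frontier_eq (D.isCompact_pointSet le_rfl) (D.isCompact_edgePts (hOE.trans hE)) hO
    (h.mono (D.edgePts_mono hOE))).notMem hx

/-- Let a path `abc` and the outer boundary `O` form two drawn edge sets `E₁`, `E₂` meeting in
that path.  Then a vertex adjacent to a vertex outside `E₂` is outside `E₂`, unless it lies on the
path. -/
theorem hasLog_of_adj {D : PlaneDrawing G} {O E₁ E₂ : Set (Sym2 V)} (h₁ : E₁ ⊆ G.edgeSet)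
    (h₂ : E₂ ⊆ G.edgeSet) (hOE : O ⊆ E₁ ∪ E₂) (hO : frontier (D.outerFace G) = D.edgePts O)
    {a b c : V} (hab₁ : s(a, b) ∈ E₁) (hbc₁ : s(b, c) ∈ E₁) (hab₂ : s(a, b) ∈ E₂)
    (hbc₂ : s(b, c) ∈ E₂) (hac : s(a, c) ∉ E₂)
    (hV : ∀ w ∈ edgeVerts E₁, w ∈ edgeVerts E₂ → w = a ∨ w = b ∨ w = c)
    (hVO : ∀ w ∈ edgeVerts E₂, w ≠ b → w ∈ edgeVerts O)
    {u w : V} (hu : HasLog (D.edgePts E₂) (D.pt u)) (huw : G.Adj u w)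
    (ha : w ≠ a) (hb : w ≠ b) (hc : w ≠ c) : HasLog (D.edgePts E₂) (D.pt w) := by
  have huE : u ∉ edgeVerts E₂ := fun h => hu.notMem ((D.pt_mem_edgePts h₂).2 h)
  have cl : ∀ {E : Set (Sym2 V)}, E ⊆ G.edgeSet → IsClosed (D.edgePts E) := fun h =>
    (D.isCompact_edgePts h).isClosed
  have hu_arc := D.pt_mem_arc (huw : s(u, w) ∈ G.edgeSet) (Sym2.mem_mk_left _ _)
  have hw_arc := D.pt_mem_arc (huw : s(u, w) ∈ G.edgeSet) (Sym2.mem_mk_right _ _)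
  by_cases hwE : w ∈ edgeVerts E₂
  · exfalso
    have hw₁ : w ∉ edgeVerts E₁ := fun h => by
      rcases hV w h hwE with h | h | h
      exacts [ha h, hb h, hc h]
    have hext : D.IsExterior G w := by
      change D.pt w ∈ frontier _
      rw [hO]
      exact (D.pt_mem_edgePts (hOE.trans (Set.union_subset h₁ h₂))).2 (hVO w hwE hb)
    obtain ⟨x, hx, hxu, hxw⟩ := D.exists_mem_arc_ne huw
    have hne : D.pt w ≠ D.pt u := fun h => huw.ne' (D.pt_injective h)
    have hx₁ : HasLog (D.edgePts E₁) x := (hext.hasLog h₁ hw₁).of_isPreconnected (cl h₁)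
      (D.isPreconnected_arc_diff huw) (D.disjoint_arc_diff h₁ huw hw₁) ⟨hw_arc, hne⟩ ⟨hx, hxu⟩
    have hx₂ : HasLog (D.edgePts E₂) x := by
      rw [Sym2.eq_swap] at hu_arc hx
      exact hu.of_isPreconnected (cl h₂) (D.isPreconnected_arc_diff huw.symm)
        (D.disjoint_arc_diff h₂ huw.symm huE) ⟨hu_arc, hne.symm⟩ ⟨hx, hxw⟩
    refine not_hasLog_of_outer_subset (Set.union_subset h₁ h₂) hOE hO
      (D.edgePts_subset_pointSet le_rfl (D.mem_edgePts.2 ⟨_, huw, hx⟩)) ?_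
    rw [edgePts_union, Set.union_comm]
    exact hx₂.union hx₁ (cl h₂) (cl h₁) (D.isPreconnected_edgePts_inter h₂ h₁ hab₂ hbc₂ hab₁ hbc₁
      hac fun w h h' => hV w h' h)
  · exact hu.of_isPreconnected (cl h₂) (D.isPreconnected_arc huw)
      (D.disjoint_arc h₂ huw huE hwE) hu_arc hw_arc

end Finite

end PlaneDrawing

section PathEdges

variable {V : Type*}

/-- The edges between consecutive entries of a list of vertices. -/
def pathEdges : List V → List (Sym2 V)
  | [] => []
  | [_] => []
  | a :: b :: l => s(a, b) :: pathEdges (b :: l)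

@[simp] theorem pathEdges_singleton (a : V) : pathEdges [a] = [] := rfl

@[simp] theorem pathEdges_cons_cons (a b : V) (l : List V) :
    pathEdges (a :: b :: l) = s(a, b) :: pathEdges (b :: l) := rfl

theorem pathEdges_append (l : List V) (b : V) (l' : List V) :
    pathEdges (l ++ b :: l') = pathEdges (l ++ [b]) ++ pathEdges (b :: l') := by
  induction l with
  | nil => rfl
  | cons a l ih =>
    cases l with
    | nil => rfl
    | cons c l => simpa using ih

theorem pathEdges_reverse (l : List V) : pathEdges l.reverse = (pathEdges l).reverse := by
  induction l with
  | nil => rfl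
  | cons a l ih =>
    cases l with
    | nil => rfl
    | cons b l =>
      rw [List.reverse_cons, List.reverse_cons, List.append_assoc, List.singleton_append,
        pathEdges_append, ← List.reverse_cons, ih]
      simp [Sym2.eq_swap]

theorem cycEdges_cons (a : V) (l : List V) : cycEdges (a :: l) = pathEdges (a :: (l ++ [a])) := by
  have key : ∀ (l : List V) (b : V),
      List.zipWith (fun a b => s(a, b)) (b :: l) (l ++ [a]) = pathEdges (b :: (l ++ [a])) := by
    intro l
    induction l with
    | nil => intro b; rfl
    | cons c l ih => intro b; simpa using ih c
  simpa [cycEdges] using key l a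

theorem forall_mem_pathEdges_iff (G : SimpleGraph V) (l : List V) :
    (∀ e ∈ pathEdges l, e ∈ G.edgeSet) ↔ l.IsChain G.Adj := by
  induction l with
  | nil => simp [pathEdges]
  | cons a l ih =>
    cases l with
    | nil => simp
    | cons b l => simp [ih]

theorem isClosedWalk_cons (G : SimpleGraph V) (a : V) (l : List V) :
    IsClosedWalk G (a :: l) ↔ (a :: (l ++ [a])).IsChain G.Adj := by
  rw [← forall_mem_pathEdges_iff, IsClosedWalk, cycEdges_cons]

theorem mem_of_mem_pathEdges {l : List V} {e : Sym2 V} (he : e ∈ pathEdges l) {w : V}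
    (hw : w ∈ e) : w ∈ l := by
  induction l with
  | nil => simp [pathEdges] at he
  | cons a l ih =>
    cases l with
    | nil => simp at he
    | cons b l =>
      rcases List.mem_cons.1 he with rfl | he
      · rcases Sym2.mem_iff.1 hw with rfl | rfl <;> simp
      · exact List.mem_cons_of_mem _ (ih he)

theorem exists_mem_pathEdges {a b : V} {l : List V} {w : V} (hw : w ∈ a :: b :: l) :
    ∃ e ∈ pathEdges (a :: b :: l), w ∈ e := by
  induction l generalizing a b with
  | nil => simpa using hw
  | cons c l ih =>
    rcases List.mem_cons.1 hw with rfl | hw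
    · exact ⟨_, List.mem_cons_self, Sym2.mem_mk_left _ _⟩
    · obtain ⟨e, he, hwe⟩ := ih hw
      exact ⟨e, List.mem_cons_of_mem _ he, hwe⟩

theorem edgeVerts_union (E F : Set (Sym2 V)) :
    edgeVerts (E ∪ F) = edgeVerts E ∪ edgeVerts F := by
  ext w
  simp [edgeVerts, or_and_right, exists_or]

theorem edgeVerts_insert (a b : V) (E : Set (Sym2 V)) :
    edgeVerts (insert s(a, b) E) = {a, b} ∪ edgeVerts E := by
  ext w
  simp [edgeVerts]

theorem edgeVerts_singleton (a b : V) : edgeVerts {s(a, b)} = {a, b} := by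
  ext w
  simp [edgeVerts]

theorem edgeVerts_pathEdges (a c : V) (l : List V) :
    edgeVerts {e | e ∈ pathEdges (a :: (l ++ [c]))} = {w | w = a ∨ w = c ∨ w ∈ l} := by
  ext w
  have : w ∈ a :: (l ++ [c]) ↔ w = a ∨ w = c ∨ w ∈ l := by simp; tauto
  rw [Set.mem_ofPred_eq, ← this]
  constructor
  · rintro ⟨e, he, hw⟩
    exact mem_of_mem_pathEdges he hw
  · intro h
    cases l with
    | nil => exact exists_mem_pathEdges h
    | cons b l => exact exists_mem_pathEdges h

theorem List.IsChain.forall_of_head {G : SimpleGraph V} {P : V → Prop} {l : List V}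
    (hl : l.IsChain G.Adj) {a : V} (ha : l.head? = some a) (hPa : P a)
    (hP : ∀ u w, P u → G.Adj u w → w ∈ l → P w) : ∀ w ∈ l, P w := by
  induction l generalizing a with
  | nil => simp
  | cons b l ih =>
    obtain rfl : b = a := by simpa using ha
    intro w hw
    rcases List.mem_cons.1 hw with rfl | hw
    · exact hPa
    cases l with
    | nil => simp at hw
    | cons c l =>
      rw [List.isChain_cons_cons] at hl
      exact ih hl.2 rfl (hP _ _ hPa hl.1 (by simp))
        (fun u w h1 h2 h3 => hP u w h1 h2 (List.mem_cons_of_mem _ h3)) w hw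

theorem List.IsChain.getLast_of_mem {G : SimpleGraph V} {P : V → Prop} {l : List V}
    (hl : l.IsChain G.Adj) {b : V} (hb : l.getLast? = some b) {a : V} (ha : a ∈ l) (hPa : P a)
    (hP : ∀ u w, P u → G.Adj u w → w ∈ l → P w) : P b := by
  obtain ⟨s, t, rfl⟩ := List.append_of_mem ha
  have ht : (a :: t).getLast? = some b := by simpa using hb
  exact (hl.right_of_append).forall_of_head rfl hPa
    (fun u w h1 h2 h3 => hP u w h1 h2 (List.mem_append_right _ h3)) b (List.mem_of_getLast? ht)

variable {G : SimpleGraph V}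

theorem edges_eq_pathEdges {u v : V} (w : G.Walk u v) : w.edges = pathEdges w.support := by
  induction w with
  | nil => rfl
  | cons h p ih =>
    rw [SimpleGraph.Walk.edges_cons, ih, SimpleGraph.Walk.support_cons, ← p.cons_tail_support,
      pathEdges_cons_cons]

theorem exists_walk_support (l : List V) {u v : V} (hu : l.head? = some u)
    (hv : l.getLast? = some v) (hl : l.IsChain G.Adj) : ∃ w : G.Walk u v, w.support = l := by
  have hne : l ≠ [] := by rintro rfl; simp at hu
  obtain rfl : l.head hne = u := by simpa [List.head?_eq_some_head hne] using hu
  obtain rfl : l.getLast hne = v := by simpa [List.getLast?_eq_some_getLast hne] using hv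
  exact ⟨.ofSupport l hne hl, SimpleGraph.Walk.support_ofSupport hne hl⟩

/-- A circle through all vertices, as a Hamiltonian cycle. -/
theorem IsCircle.exists_isHamiltonianCycle [DecidableEq V] {a : V} {l : List V}
    (h : IsCircle G (a :: l)) (hall : ∀ w, w ∈ a :: l) :
    ∃ H : G.Walk a a, H.IsHamiltonianCycle ∧ H.support = a :: (l ++ [a]) := by
  obtain ⟨h3, hnd, hw⟩ := h
  rw [isClosedWalk_cons] at hw
  match l, h3, hnd, hw, hall with
  | b :: c :: l, _, hnd, hw, hall =>
    have hw' := List.isChain_cons_cons.1 (show (a :: b :: (c :: l ++ [a])).IsChain G.Adj from hw)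
    obtain ⟨p, hp⟩ := exists_walk_support (u := b) (v := a) _ rfl
      (by rw [← List.cons_append, List.getLast?_concat]) hw'.2
    have hpath : p.IsPath := by
      rw [SimpleGraph.Walk.isPath_def, hp]
      simp only [List.nodup_cons, List.mem_cons, List.nodup_append, List.cons_append,
        List.mem_append] at hnd ⊢
      grind
    refine ⟨.cons hw'.1 p, ⟨?_, ?_⟩, by simp [hp]⟩
    · rw [SimpleGraph.Walk.cons_isCycle_iff]
      refine ⟨hpath, fun he => ?_⟩
      rw [edges_eq_pathEdges, hp] at he
      simp only [List.cons_append, pathEdges_cons_cons, List.mem_cons] at he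
      simp only [List.nodup_cons, List.mem_cons, not_or] at hnd
      rcases he with he | he
      · rcases Sym2.eq_iff.1 he with ⟨h1, -⟩ | ⟨h1, -⟩
        · exact hnd.1.1 h1
        · exact hnd.1.2.1 h1
      · have := mem_of_mem_pathEdges he (Sym2.mem_mk_right _ _)
        simp only [List.mem_cons, List.mem_append] at this
        have := hnd.1.1
        grind
    · refine SimpleGraph.Walk.IsPath.isHamiltonian_of_mem (by simpa using hpath) fun w => ?_
      have := hall w
      simp [hp] at this ⊢
      tauto

/-- The product of the signs of the edges between consecutive entries. -/
def pathSign (σ : Sym2 V → ℤˣ) (l : List V) : ℤˣ := ((pathEdges l).map σ).prod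

variable (σ : Sym2 V → ℤˣ)

@[simp] theorem pathSign_singleton (a : V) : pathSign σ [a] = 1 := rfl

theorem pathSign_cons_cons (a b : V) (l : List V) :
    pathSign σ (a :: b :: l) = σ s(a, b) * pathSign σ (b :: l) := by simp [pathSign]

theorem pathSign_append (l : List V) (b : V) (l' : List V) :
    pathSign σ (l ++ b :: l') = pathSign σ (l ++ [b]) * pathSign σ (b :: l') := by
  rw [pathSign, pathEdges_append, List.map_append, List.prod_append]; rfl

theorem pathSign_reverse (l : List V) : pathSign σ l.reverse = pathSign σ l := by
  rw [pathSign, pathEdges_reverse, List.map_reverse, List.prod_reverse]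
  rfl

theorem pathSign_cons_append (a : V) {r : List V} {b d : V} (hb : r.head? = some b)
    (hd : r.getLast? = some d) (c : V) (l : List V) :
    pathSign σ (a :: (r ++ c :: l)) =
      σ s(a, b) * pathSign σ r * σ s(d, c) * pathSign σ (c :: l) := by
  obtain ⟨r', rfl⟩ : ∃ r', r = r' ++ [d] := by
    obtain ⟨h, e⟩ := List.getLast?_eq_some_iff.1 hd
    exact ⟨h, e⟩
  have h1 : pathSign σ (a :: (r' ++ [d])) = σ s(a, b) * pathSign σ (r' ++ [d]) := by
    cases r' with
    | nil => obtain rfl : d = b := by simpa using hb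
             exact pathSign_cons_cons σ _ _ _
    | cons x r' => obtain rfl : x = b := by simpa using hb
                   exact pathSign_cons_cons σ _ _ _
  rw [List.append_assoc, List.singleton_append, ← List.cons_append, pathSign_append,
    pathSign_cons_cons, List.cons_append, h1]
  simp only [mul_assoc]

theorem cycSign_cons (a : V) (l : List V) :
    cycSign σ (a :: l) = pathSign σ (a :: (l ++ [a])) := by
  rw [cycSign, cycEdges_cons]; rfl

theorem walkSign_eq {u v : V} (w : G.Walk u v) : walkSign σ w = pathSign σ w.support := by
  rw [walkSign, edges_eq_pathEdges]; rfl

end PathEdges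

namespace PlaneDrawing

variable {V : Type*} {G : SimpleGraph V}

theorem curve_eq_edgePts (D : PlaneDrawing G) (l : List V) :
    D.curve l = D.edgePts {e | e ∈ cycEdges l} := rfl

theorem inside_iff [Finite V] (D : PlaneDrawing G) {l : List V} (hl : IsClosedWalk G l) (w : V) :
    D.Inside l w ↔ w ∉ edgeVerts {e | e ∈ cycEdges l} ∧
      ¬ HasLog (D.edgePts {e | e ∈ cycEdges l}) (D.pt w) := by
  have hE : {e | e ∈ cycEdges l} ⊆ G.edgeSet := hl
  rw [Inside, curve_eq_edgePts, mem_insideOf_iff (D.isCompact_edgePts hE), D.pt_mem_edgePts hE]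

theorem IsOuterCircle.isExterior_iff {D : PlaneDrawing G} {G' : SimpleGraph V} (hG : G' ≤ G)
    {a b : V} {l : List V} (h : D.IsOuterCircle G' (a :: b :: l)) (w : V) :
    D.IsExterior G' w ↔ w ∈ a :: b :: l := by
  have hE : {e | e ∈ cycEdges (a :: b :: l)} ⊆ G.edgeSet := fun e he =>
    SimpleGraph.edgeSet_mono hG (h.1.2.2 e he)
  rw [IsExterior, h.2, curve_eq_edgePts, D.pt_mem_edgePts hE, cycEdges_cons, edgeVerts_pathEdges]
  simp

/-- Let the outer boundary be the circle `a m c d nʳ e a` and let `abc` be a path through the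
interior.  Some set `P` of vertices contains `m`, is closed under passing to neighbours that are
not on `abc`, and misses `d`, `e` and `n`. -/
theorem exists_side [Finite V] (D : PlaneDrawing G) {a b c d e : V} {m n : List V}
    (hnd : ([a, b, c, d, e] ++ m ++ n).Nodup)
    (hab : G.Adj a b) (hbc : G.Adj b c) (hae : G.Adj a e) (hcd : G.Adj c d)
    (hm : (a :: (m ++ [c])).IsChain G.Adj) (hn : (e :: (n ++ [d])).IsChain G.Adj)
    (hO : frontier (D.outerFace G) = D.edgePts ({x | x ∈ pathEdges (a :: (m ++ [c]))} ∪
      {x | x ∈ pathEdges (e :: (n ++ [d]))} ∪ {s(a, e), s(c, d)})) :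
    ∃ P : V → Prop, (∀ u w, P u → G.Adj u w → w ≠ a → w ≠ b → w ≠ c → P w) ∧
      (∀ w ∈ m, P w) ∧ ∀ w, P w → w ≠ d ∧ w ≠ e ∧ w ∉ n := by
  rw [← forall_mem_pathEdges_iff] at hm hn
  set M : Set (Sym2 V) := {x | x ∈ pathEdges (a :: (m ++ [c]))} with hM
  set N : Set (Sym2 V) := {x | x ∈ pathEdges (e :: (n ++ [d]))} with hN
  have vM : edgeVerts M = {w | w = a ∨ w = c ∨ w ∈ m} := edgeVerts_pathEdges _ _ _
  have vN : edgeVerts N = {w | w = e ∨ w = d ∨ w ∈ n} := edgeVerts_pathEdges _ _ _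
  have h₁ : M ∪ {s(a, b), s(b, c)} ⊆ G.edgeSet := by
    rintro x (hx | rfl | rfl)
    exacts [hm x hx, hab, hbc]
  have h₂ : N ∪ {s(a, b), s(b, c), s(a, e), s(c, d)} ⊆ G.edgeSet := by
    rintro x (hx | rfl | rfl | rfl | rfl)
    exacts [hn x hx, hab, hbc, hae, hcd]
  have hO' : M ∪ N ∪ {s(a, e), s(c, d)} ⊆ G.edgeSet := by
    rintro x ((hx | hx) | rfl | rfl)
    exacts [hm x hx, hn x hx, hae, hcd]
  have v₁ : ∀ w, w ∈ edgeVerts (M ∪ {s(a, b), s(b, c)}) ↔ w = a ∨ w = b ∨ w = c ∨ w ∈ m := by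
    intro w
    simp only [edgeVerts_union, edgeVerts_insert, edgeVerts_singleton, vM, Set.mem_union,
      Set.mem_insert_iff, Set.mem_singleton_iff, Set.mem_ofPred_eq]
    tauto
  have v₂ : ∀ w, w ∈ edgeVerts (N ∪ {s(a, b), s(b, c), s(a, e), s(c, d)}) ↔
      w = a ∨ w = b ∨ w = c ∨ w = d ∨ w = e ∨ w ∈ n := by
    intro w
    simp only [edgeVerts_union, edgeVerts_insert, edgeVerts_singleton, vN, Set.mem_union,
      Set.mem_insert_iff, Set.mem_singleton_iff, Set.mem_ofPred_eq]
    tauto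
  have vO : ∀ w, w ∈ edgeVerts (M ∪ N ∪ {s(a, e), s(c, d)}) ↔
      w = a ∨ w = c ∨ w = d ∨ w = e ∨ w ∈ m ∨ w ∈ n := by
    intro w
    simp only [edgeVerts_union, edgeVerts_insert, edgeVerts_singleton, vM, vN, Set.mem_union,
      Set.mem_insert_iff, Set.mem_singleton_iff, Set.mem_ofPred_eq]
    tauto
  simp only [List.cons_append, List.nil_append, List.nodup_cons, List.mem_cons, List.mem_append,
    not_or, List.nodup_append] at hnd
  have hac : s(a, c) ∉ N ∪ {s(a, b), s(b, c), s(a, e), s(c, d)} := by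
    rintro (h | h)
    · have : a ∈ edgeVerts N := ⟨_, h, Sym2.mem_mk_left _ _⟩
      rw [vN, Set.mem_ofPred_eq] at this
      grind
    · simp only [Set.mem_insert_iff, Set.mem_singleton_iff, Sym2.eq_iff] at h
      grind
  refine ⟨fun w => HasLog (D.edgePts (N ∪ {s(a, b), s(b, c), s(a, e), s(c, d)})) (D.pt w),
    fun u w hu huw ha hb hc => hasLog_of_adj h₁ h₂ ?_ hO (by simp) (by simp) (by simp) (by simp)
      hac ?_ ?_ hu huw ha hb hc, fun w hw => ?_, fun w hw => ?_⟩
  · rintro x ((hx | hx) | rfl | rfl)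
    exacts [.inl (.inl hx), .inr (.inl hx), by simp, by simp]
  · intro w hw₁ hw₂
    rw [v₁] at hw₁
    rw [v₂] at hw₂
    grind
  · intro w hw₂ hb
    rw [v₂] at hw₂
    rw [vO]
    tauto
  · refine IsExterior.hasLog ?_ h₂ ?_
    · rw [IsExterior, hO, D.pt_mem_edgePts hO', vO]
      tauto
    · rw [v₂]
      grind
  · have := mt (D.pt_mem_edgePts h₂).2 hw.notMem
    rw [v₂] at this
    tauto

/-- If three drawn edge sets, consecutive ones meeting in paths of two edges, contain the outer
boundary, then every vertex off them is separated from infinity by one of them. -/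
theorem not_hasLog_of_three [Finite V] (D : PlaneDrawing G) {O E₁ E₂ E₃ : Set (Sym2 V)}
    (h₁ : E₁ ⊆ G.edgeSet) (h₂ : E₂ ⊆ G.edgeSet) (h₃ : E₃ ⊆ G.edgeSet) (hOE : O ⊆ E₁ ∪ E₂ ∪ E₃)
    (hO : frontier (D.outerFace G) = D.edgePts O)
    (h₁₂ : IsPreconnected (D.edgePts E₁ ∩ D.edgePts E₂))
    (h₁₂₃ : IsPreconnected (D.edgePts (E₁ ∪ E₂) ∩ D.edgePts E₃)) (w : V)
    (l₁ : HasLog (D.edgePts E₁) (D.pt w)) (l₂ : HasLog (D.edgePts E₂) (D.pt w)) :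
    ¬ HasLog (D.edgePts E₃) (D.pt w) := by
  intro l₃
  have hu := Set.union_subset h₁ h₂
  have l₁₂ := l₁.union l₂ (D.isCompact_edgePts h₁).isClosed (D.isCompact_edgePts h₂).isClosed h₁₂
  rw [← edgePts_union] at l₁₂
  refine not_hasLog_of_outer_subset (Set.union_subset hu h₃) hOE hO (D.pt_mem_pointSet G w) ?_
  rw [edgePts_union]
  exact l₁₂.union l₃ (D.isCompact_edgePts hu).isClosed (D.isCompact_edgePts h₃).isClosed h₁₂₃

end PlaneDrawing

theorem isChain_cons_reverse_append {V : Type*} {G : SimpleGraph V} {a b : V} {l : List V} :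
    (a :: (l.reverse ++ [b])).IsChain G.Adj ↔ (b :: (l ++ [a])).IsChain G.Adj := by
  rw [← forall_mem_pathEdges_iff, ← forall_mem_pathEdges_iff,
    show a :: (l.reverse ++ [b]) = (b :: (l ++ [a])).reverse by simp, pathEdges_reverse]
  simp

theorem mem_pathEdges_cons_reverse_append {V : Type*} {a b : V} {l : List V} {e : Sym2 V} :
    e ∈ pathEdges (a :: (l.reverse ++ [b])) ↔ e ∈ pathEdges (b :: (l ++ [a])) := by
  rw [show a :: (l.reverse ++ [b]) = (b :: (l ++ [a])).reverse by simp, pathEdges_reverse]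
  simp

theorem mem_pathEdges_cons_append_cons {V : Type*} {a : V} {l : List V} {b : V}
    {l' : List V} {e : Sym2 V} : e ∈ pathEdges (a :: (l ++ b :: l')) ↔
      e ∈ pathEdges (a :: (l ++ [b])) ∨ e ∈ pathEdges (b :: l') := by
  rw [← List.cons_append, pathEdges_append, List.mem_append, List.cons_append]

theorem isChain_of_cons_append {V : Type*} {G : SimpleGraph V} {a b : V} {l : List V}
    (h : (a :: (l ++ [b])).IsChain G.Adj) : l.IsChain G.Adj :=
  h.tail.left_of_append

namespace PlaneDrawing

variable {V : Type*} {G : SimpleGraph V}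

/-- The left circle, the hexagon and the right circle cover all vertices of the disk. -/
theorem mem_or_inside [Finite V] (D : PlaneDrawing G) {v₁ v₂ v₃ v₄ r₁ rₜ : V} {p q : List V}
    (hnd : ([v₁, v₂, v₃, v₄] ++ p ++ q).Nodup)
    (hr₁ : r₁ ∉ [v₁, v₂, v₃, v₄] ++ p ++ q) (hrₜ : rₜ ∉ [v₁, v₂, v₃, v₄] ++ p ++ q)
    (hout : D.IsOuterCircle G ([v₁, v₂] ++ q ++ [v₃, v₄] ++ p.reverse))
    (hH : IsClosedWalk G [v₁, v₂, rₜ, v₃, v₄, r₁])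
    (hL : IsClosedWalk G ([v₁, r₁, v₄] ++ p.reverse))
    (hR : IsClosedWalk G ([v₂] ++ q ++ [v₃, rₜ])) (w : V) :
    w ∈ [v₁, v₂, v₃, v₄, r₁, rₜ] ++ p ++ q ∨ D.Inside ([v₁, r₁, v₄] ++ p.reverse) w ∨
      D.Inside [v₁, v₂, rₜ, v₃, v₄, r₁] w ∨ D.Inside ([v₂] ++ q ++ [v₃, rₜ]) w := by
  rw [D.inside_iff hL, D.inside_iff hH, D.inside_iff hR]
  have eL : ∀ e, e ∈ cycEdges ([v₁, r₁, v₄] ++ p.reverse) ↔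
      e = s(v₁, r₁) ∨ e = s(r₁, v₄) ∨ e ∈ pathEdges (v₁ :: (p ++ [v₄])) := by
    intro e
    simp only [List.cons_append, List.nil_append, cycEdges_cons, pathEdges_cons_cons,
      List.mem_cons, mem_pathEdges_cons_reverse_append]
  have eR : ∀ e, e ∈ cycEdges ([v₂] ++ q ++ [v₃, rₜ]) ↔
      e ∈ pathEdges (v₂ :: (q ++ [v₃])) ∨ e = s(v₃, rₜ) ∨ e = s(rₜ, v₂) := by
    intro e
    simp only [List.cons_append, List.nil_append, List.append_assoc, cycEdges_cons,
      mem_pathEdges_cons_append_cons (l' := rₜ :: _), pathEdges_cons_cons, pathEdges_singleton,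
      List.mem_cons, List.not_mem_nil, or_false]
  have eH : ∀ e, e ∈ cycEdges [v₁, v₂, rₜ, v₃, v₄, r₁] ↔ e = s(v₁, v₂) ∨ e = s(v₂, rₜ) ∨
      e = s(rₜ, v₃) ∨ e = s(v₃, v₄) ∨ e = s(v₄, r₁) ∨ e = s(r₁, v₁) := by
    intro e
    simp [cycEdges_cons]
  have eO : ∀ e, e ∈ cycEdges ([v₁, v₂] ++ q ++ [v₃, v₄] ++ p.reverse) ↔
      e = s(v₁, v₂) ∨ e ∈ pathEdges (v₂ :: (q ++ [v₃])) ∨ e = s(v₃, v₄) ∨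
        e ∈ pathEdges (v₁ :: (p ++ [v₄])) := by
    intro e
    simp only [List.cons_append, List.nil_append, List.append_assoc, cycEdges_cons,
      mem_pathEdges_cons_append_cons (l' := v₄ :: _), pathEdges_cons_cons, List.mem_cons,
      mem_pathEdges_cons_reverse_append]
  set EL : Set (Sym2 V) := {e | e ∈ cycEdges ([v₁, r₁, v₄] ++ p.reverse)} with hEL
  set EH : Set (Sym2 V) := {e | e ∈ cycEdges [v₁, v₂, rₜ, v₃, v₄, r₁]} with hEH
  set ER : Set (Sym2 V) := {e | e ∈ cycEdges ([v₂] ++ q ++ [v₃, rₜ])} with hER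
  have cL : EL ⊆ G.edgeSet := hL
  have cH : EH ⊆ G.edgeSet := hH
  have cR : ER ⊆ G.edgeSet := hR
  have vL : ∀ w, w ∈ edgeVerts EL ↔ w = v₁ ∨ w = r₁ ∨ w = v₄ ∨ w ∈ p := by
    intro w
    have := edgeVerts_pathEdges v₁ (v₁) (r₁ :: v₄ :: p.reverse)
    rw [hEL, show [v₁, r₁, v₄] ++ p.reverse = v₁ :: (r₁ :: v₄ :: p.reverse) from rfl,
      cycEdges_cons, this]
    simp
  have vR : ∀ w, w ∈ edgeVerts ER ↔ w = v₂ ∨ w = rₜ ∨ w = v₃ ∨ w ∈ q := by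
    intro w
    have := edgeVerts_pathEdges v₂ v₂ (q ++ [v₃, rₜ])
    rw [hER, show [v₂] ++ q ++ [v₃, rₜ] = v₂ :: (q ++ [v₃, rₜ]) from rfl, cycEdges_cons, this]
    simp
    clear * -
    tauto
  have vH : ∀ w, w ∈ edgeVerts EH ↔
      w = v₁ ∨ w = v₂ ∨ w = rₜ ∨ w = v₃ ∨ w = v₄ ∨ w = r₁ := by
    intro w
    have := edgeVerts_pathEdges v₁ v₁ [v₂, rₜ, v₃, v₄, r₁]
    rw [hEH, cycEdges_cons, this]
    simp
  simp only [List.cons_append, List.nil_append, List.nodup_cons, List.mem_cons, List.mem_append,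
    not_or, List.nodup_append] at hnd hr₁ hrₜ
  have h₁₂ : IsPreconnected (D.edgePts EL ∩ D.edgePts EH) := by
    rw [Set.inter_comm]
    refine D.isPreconnected_edgePts_inter cH cL (a := v₁) (b := r₁) (c := v₄)
      ((eH _).2 (by simp [Sym2.eq_swap])) ((eH _).2 (by simp [Sym2.eq_swap])) ((eL _).2 (by simp))
      ((eL _).2 (by simp)) ?_ ?_
    · intro h
      have := (eH _).1 h
      simp only [Sym2.eq_iff] at this
      clear * - this hnd hr₁ hrₜ
      grind
    · intro w h h'
      rw [vH] at h
      rw [vL] at h'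
      clear * - h h' hnd hr₁ hrₜ
      grind
  have h₁₂₃ : IsPreconnected (D.edgePts (EL ∪ EH) ∩ D.edgePts ER) := by
    refine D.isPreconnected_edgePts_inter (Set.union_subset cL cH) cR (a := v₂) (b := rₜ) (c := v₃)
      (.inr ((eH _).2 (by simp))) (.inr ((eH _).2 (by simp)))
      ((eR _).2 (by simp [Sym2.eq_swap])) ((eR _).2 (by simp [Sym2.eq_swap])) ?_ ?_
    · rintro (h | h)
      · have h' : v₂ ∈ edgeVerts EL := ⟨_, h, Sym2.mem_mk_left _ _⟩
        rw [vL] at h'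
        clear * - h' hnd hr₁ hrₜ
        grind
      · have := (eH _).1 h
        simp only [Sym2.eq_iff] at this
        clear * - this hnd hr₁ hrₜ
        grind
    · intro w h h'
      rw [edgeVerts_union, Set.mem_union, vL, vH] at h
      rw [vR] at h'
      clear * - h h' hnd hr₁ hrₜ
      grind
  by_contra! hcon
  obtain ⟨hw, hwL, hwH, hwR⟩ := hcon
  simp only [List.cons_append, List.nil_append, List.mem_cons, List.mem_append, not_or] at hw
  rw [vL] at hwL
  rw [vH] at hwH
  rw [vR] at hwR
  refine D.not_hasLog_of_three cL cH cR (O := {e | e ∈ cycEdges _}) (fun e he => ?_) hout.2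
    h₁₂ h₁₂₃ w (hwL (by simp [hw])) (hwH (by simp [hw]))
    (hwR (by simp [hw]))
  rcases (eO e).1 he with h | h | h | h
  · exact .inl (.inr ((eH e).2 (.inl h)))
  · exact .inr ((eR e).2 (.inl h))
  · exact .inl (.inr ((eH e).2 (by simp [h])))
  · exact .inl (.inl ((eL e).2 (by simp [h])))

end PlaneDrawing

theorem isChain_cons_append_of_ends {V : Type*} {G : SimpleGraph V} {a b c d : V} {r l : List V}
    (hb : r.head? = some b) (hd : r.getLast? = some d) (hr : r.IsChain G.Adj) (hab : G.Adj a b)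
    (hdc : G.Adj d c) (hl : (c :: l).IsChain G.Adj) : (a :: (r ++ c :: l)).IsChain G.Adj := by
  refine List.IsChain.cons (hr.append hl fun x hx y hy => ?_) fun y hy => ?_
  · obtain rfl : x = d := by simpa [hd, eq_comm] using hx
    obtain rfl : y = c := by simpa [eq_comm] using hy
    exact hdc
  · obtain rfl : y = b := by simpa [hb, eq_comm] using hy
    exact hab

/-- The sign quotient of the two Hamiltonian circles. -/
theorem pathSign_div_pathSign {V : Type*} (σ : Sym2 V → ℤˣ) (v₁ v₂ v₃ v₄ r₁ rₜ : V)
    (p q r : List V) (hr₁ : r.head? = some r₁) (hrₜ : r.getLast? = some rₜ) :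
    pathSign σ (v₁ :: v₂ :: (q ++ v₃ :: (r.reverse ++ v₄ :: (p.reverse ++ [v₁])))) /
        pathSign σ (v₁ :: (r ++ v₂ :: (q ++ v₃ :: v₄ :: (p.reverse ++ [v₁])))) =
      pathSign σ (v₃ :: v₄ :: (r ++ [v₃])) / pathSign σ (v₁ :: v₂ :: (r.reverse ++ [v₁])) := by
  have hhead : r.reverse.head? = some rₜ := by simpa using hrₜ
  have hlast : r.reverse.getLast? = some r₁ := by simpa using hr₁
  have hq : ∀ l, pathSign σ (v₂ :: (q ++ v₃ :: l)) =
      pathSign σ (v₂ :: (q ++ [v₃])) * pathSign σ (v₃ :: l) := fun l =>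
    pathSign_append σ (v₂ :: q) v₃ l
  rw [pathSign_cons_cons σ v₁, hq (_ ++ _), pathSign_cons_append σ v₃ hhead hlast,
    pathSign_cons_append σ v₁ hr₁ hrₜ, hq (v₄ :: _), pathSign_cons_cons σ v₃ v₄, pathSign_cons_cons σ v₃ v₄,
    pathSign_cons_append σ v₄ hr₁ hrₜ, pathSign_cons_cons σ v₁ v₂,
    pathSign_cons_append σ v₂ hhead hlast, pathSign_reverse, pathSign_singleton,
    pathSign_singleton, Sym2.eq_swap (a := v₃) (b := rₜ), Sym2.eq_swap (a := v₄) (b := r₁),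
    Sym2.eq_swap (a := v₂) (b := rₜ), Sym2.eq_swap (a := v₁) (b := r₁)]
  generalize pathSign σ (v₂ :: (q ++ [v₃])) = Q
  generalize pathSign σ (v₄ :: (p.reverse ++ [v₁])) = P
  generalize pathSign σ r = R
  rw [div_eq_div_iff_mul_eq_mul]
  have h12 := Int.units_mul_self (σ s(v₁, v₂))
  have h34 := Int.units_mul_self (σ s(v₃, v₄))
  generalize σ s(v₁, v₂) = x at *
  generalize σ s(v₃, v₄) = y at *
  generalize σ s(rₜ, v₃) = a
  generalize σ s(rₜ, v₂) = b
  generalize σ s(r₁, v₁) = c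
  generalize σ s(r₁, v₄) = d
  calc _ = (x * x) * (Q * R * R * P * a * b * c * d) := by
        simp only [mul_one, mul_comm, mul_left_comm]
    _ = (y * y) * (Q * R * R * P * a * b * c * d) := by rw [h12, h34]
    _ = _ := by simp only [mul_one, mul_comm, mul_left_comm]

theorem List.IsChain.getLast_of_mem_ne_head {V : Type*} {G : SimpleGraph V} {P : V → Prop}
    {r : List V} (hr : r.IsChain G.Adj) (hnd : r.Nodup) {a b w : V} (ha : r.head? = some a)
    (hb : r.getLast? = some b) (hw : w ∈ r) (hwa : w ≠ a) (hPw : P w)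
    (hP : ∀ u x, P u → G.Adj u x → x ∈ r → x ≠ a → P x) : a ≠ b ∧ P b := by
  cases r with
  | nil => simp at hw
  | cons x r =>
    obtain rfl : x = a := by simpa using ha
    have hw' : w ∈ r := (List.mem_cons.1 hw).resolve_left hwa
    obtain ⟨y, l, rfl⟩ := List.exists_cons_of_ne_nil (List.ne_nil_of_mem hw')
    have hl : (y :: l).getLast? = some b := by simpa using hb
    have hx := (List.nodup_cons.1 hnd).1
    exact ⟨(ne_of_mem_of_not_mem (List.mem_of_getLast? hl) hx).symm,
      hr.tail.getLast_of_mem hl hw' hPw fun u z hu huz hz =>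
        hP u z hu huz (List.mem_cons_of_mem _ hz) (ne_of_mem_of_not_mem hz hx)⟩

theorem mainTheorem3 {V : Type*} [Fintype V] [DecidableEq V]
    -- a simple plane signed graph
    (G : SimpleGraph V) (D : PlaneDrawing G) (σ : Sym2 V → ℤˣ)
    -- the named vertices; `p'`, `q'`, `r` are the sequences `p'₁…p'ₖ`, `q'₁…q'ₗ`, `r₁…rₜ`
    (v₁ v₂ v₃ v₄ r₁ rₜ : V) (p' q' r : List V)
    (hp' : p' ≠ []) (hq' : q' ≠ [])
    (hr₁ : r.head? = some r₁) (hrₜ : r.getLast? = some rₜ)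
    (hdistinct : ([v₁, v₂, v₃, v₄] ++ p' ++ q' ++ r).Nodup)
    -- the outer circle, the hexagon (with `r₁ = rₜ` allowed), and the circles `C'_L`, `C'_R`
    (hout : D.IsOuterCircle G ([v₁, v₂] ++ q' ++ [v₃, v₄] ++ p'.reverse))
    (hhex : IsClosedWalk G [v₁, v₂, rₜ, v₃, v₄, r₁])
    (hCL' : IsCircle G ([v₁, r₁, v₄] ++ p'.reverse))
    (hCR' : IsCircle G ([v₂] ++ q' ++ [v₃, rₜ]))
    -- the path `R`: its inner vertices are exactly the vertices inside the hexagon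
    (hR : r.IsChain G.Adj)
    (hRin : ∀ w ∈ r, w ≠ r₁ → w ≠ rₜ → D.Inside [v₁, v₂, rₜ, v₃, v₄, r₁] w)
    (hinR : ∀ w : V, D.Inside [v₁, v₂, rₜ, v₃, v₄, r₁] w → w ∈ r)
    -- left release: the new outer path `p` replaces `p'`
    (EL : Set (Sym2 V)) (p : List V)
    (hp₁ : p.head? = p'.head?) (hpₖ : p.getLast? = p'.getLast?)
    (hL : D.Release EL ([v₁, r₁, v₄] ++ p'.reverse) ([v₁, r₁, v₄] ++ p.reverse)
      ([v₁, v₂] ++ q' ++ [v₃, v₄] ++ p.reverse))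
    -- right release: the new outer path `q` replaces `q'`
    (ER : Set (Sym2 V)) (q : List V)
    (hq₁ : q.head? = q'.head?) (hqₗ : q.getLast? = q'.getLast?)
    (hRel : D.Release ER ([v₂] ++ q' ++ [v₃, rₜ]) ([v₂] ++ q ++ [v₃, rₜ])
      ([v₁, v₂] ++ q ++ [v₃, v₄] ++ p'.reverse)) :
    (∃ H₁ H₂ : G.Walk v₁ v₁,
      H₁.IsHamiltonianCycle ∧
      H₁.support = [v₁, v₂] ++ q ++ [v₃] ++ r.reverse ++ [v₄] ++ p.reverse ++ [v₁] ∧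
      H₂.IsHamiltonianCycle ∧
      H₂.support = [v₁] ++ r ++ [v₂] ++ q ++ [v₃, v₄] ++ p.reverse ++ [v₁] ∧
      walkSign σ H₁ / walkSign σ H₂ =
        cycSign σ ([v₃, v₄] ++ r) / cycSign σ ([v₁, v₂] ++ r.reverse)) ∧
    (cycSign σ ([v₁, v₂] ++ r.reverse) ≠ cycSign σ ([v₃, v₄] ++ r) →
      (∃ (u : V) (H : G.Walk u u), H.IsHamiltonianCycle ∧ walkSign σ H = 1) ∧
      (∃ (u : V) (H : G.Walk u u), H.IsHamiltonianCycle ∧ walkSign σ H = -1)) := by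
  have hcO := hout.1.2.2
  have hcH := hhex
  have hleL : G.deleteEdges EL ≤ G := G.deleteEdges_le EL
  have hleR : G.deleteEdges ER ≤ G := G.deleteEdges_le ER
  have hcl : IsClosedWalk G _ := fun e he => SimpleGraph.edgeSet_mono hleL (hL.circle.2.2 e he)
  have hcr : IsClosedWalk G _ := fun e he => SimpleGraph.edgeSet_mono hleR (hRel.circle.2.2 e he)
  have ndl := hL.circle.2.1
  have ndr := hRel.circle.2.1
  have ndol := hL.outer.1.2.1
  have ndor := hRel.outer.1.2.1
  simp only [List.cons_append, List.nil_append, List.append_assoc, isClosedWalk_cons,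
    List.isChain_cons_cons, List.isChain_cons_append_cons_cons, List.IsChain.singleton, and_true,
    isChain_cons_reverse_append] at hcO hcH hcl hcr
  obtain ⟨h12, hchq', h34, hchp'⟩ := hcO
  obtain ⟨-, h2t, ht3, -, h4r, hr1⟩ := hcH
  obtain ⟨-, -, hchp⟩ := hcl
  obtain ⟨hchq, -, -⟩ := hcr
  obtain ⟨p₁, hp₁'⟩ : ∃ x, p'.head? = some x := ⟨_, List.head?_eq_some_head hp'⟩
  obtain ⟨q₁, hq₁'⟩ : ∃ x, q'.head? = some x := ⟨_, List.head?_eq_some_head hq'⟩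
  obtain ⟨qₗ, hqₗ'⟩ : ∃ x, q'.getLast? = some x := ⟨_, List.getLast?_eq_some_getLast hq'⟩
  have hr₁m : r₁ ∈ r := List.mem_of_head? hr₁
  have hrₜm : rₜ ∈ r := List.mem_of_getLast? hrₜ
  have hO : frontier (D.outerFace G) = D.edgePts ({x | x ∈ pathEdges (v₁ :: (p' ++ [v₄]))} ∪
      {x | x ∈ pathEdges (v₂ :: (q' ++ [v₃]))} ∪ {s(v₁, v₂), s(v₄, v₃)}) := by
    rw [hout.2, D.curve_eq_edgePts]
    congr 1
    ext e
    simp only [List.cons_append, List.nil_append, List.append_assoc, cycEdges_cons,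
      mem_pathEdges_cons_append_cons (l' := v₄ :: _), pathEdges_cons_cons, List.mem_cons,
      mem_pathEdges_cons_reverse_append, Set.mem_union, Set.mem_ofPred_eq, Set.mem_insert_iff,
      Set.mem_singleton_iff, Sym2.eq_swap (a := v₄) (b := v₃)]
    tauto
  have hnd5 : ∀ b ∈ r, ([v₁, v₂, v₃, v₄] ++ p' ++ q' ++ [b]).Nodup := fun b hb =>
    hdistinct.sublist ((List.append_sublist_append_left _).2 (List.singleton_sublist.2 hb))
  have hnd4 := hdistinct.of_append_left
  have hrnot : ∀ b ∈ r, b ∉ [v₁, v₂, v₃, v₄] ++ p' ++ q' := fun b hb h =>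
    List.disjoint_of_nodup_append hdistinct h hb
  simp only [List.cons_append, List.nil_append, List.append_assoc, List.nodup_cons, List.mem_cons,
    List.mem_append, not_or, List.nodup_append, List.mem_reverse, List.nodup_reverse,
    List.not_mem_nil, not_false_eq_true, and_true, List.nodup_nil]
    at hdistinct ndl ndr ndol ndor
  obtain ⟨⟨n12, n13, n14, n1p, n1q, n1r⟩, ⟨n23, n24, n2p, n2q, n2r⟩, ⟨n34, n3p, n3q, n3r⟩,
    ⟨n4p, n4q, n4r⟩, -, ⟨-, ndr', -⟩, dpq⟩ := hdistinct
  obtain ⟨⟨-, -, v1p⟩, ⟨-, r1p⟩, v4p, ndp⟩ := ndl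
  obtain ⟨⟨v2q, -, -⟩, ndq, -, dq⟩ := ndr
  obtain ⟨-, ⟨-, -, -, v2p⟩, -, ⟨⟨-, v3p⟩, -, -⟩, -⟩ := ndol
  obtain ⟨⟨-, v1q, -⟩, -, -, -, dq'⟩ := ndor
  have v3q : v₃ ∉ q := fun h => dq _ h _ (.inl rfl) rfl
  have rtq : rₜ ∉ q := fun h => dq _ h _ (.inr (.inl rfl)) rfl
  have v4q : v₄ ∉ q := fun h => dq' _ h _ (.inr (.inl rfl)) rfl
  obtain ⟨P, hPadj, hPp', hPnot⟩ := D.exists_side (a := v₁) (b := r₁) (c := v₄) (d := v₃) (e := v₂)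
    (m := p') (n := q') ((List.Perm.nodup_iff (List.perm_iff_count.2 fun x => by
      simp only [List.count_append, List.count_cons, List.count_nil]; omega)).1 (hnd5 r₁ hr₁m))
    hr1.symm h4r.symm h12 h34.symm hchp' hchq' hO
  obtain ⟨Q, hQadj, hQq', hQnot⟩ := D.exists_side (a := v₂) (b := rₜ) (c := v₃) (d := v₄) (e := v₁)
    (m := q') (n := p') ((List.Perm.nodup_iff (List.perm_iff_count.2 fun x => by
      simp only [List.count_append, List.count_cons, List.count_nil]; omega)).1 (hnd5 rₜ hrₜm))
    h2t ht3 h12.symm h34 hchq' hchp' (by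
      rw [hO, Sym2.eq_swap (a := v₂), Sym2.eq_swap (a := v₄),
        Set.union_comm {x | x ∈ pathEdges (v₁ :: _)}])
  have hPp : ∀ w ∈ p, P w := (isChain_of_cons_append hchp).forall_of_head (hp₁.trans hp₁')
    (hPp' _ (List.mem_of_head? hp₁')) fun u w hu huw hw =>
      hPadj u w hu huw (ne_of_mem_of_not_mem hw v1p) (ne_of_mem_of_not_mem hw r1p)
        (ne_of_mem_of_not_mem hw v4p)
  have hQq : ∀ w ∈ q, Q w := (isChain_of_cons_append hchq).forall_of_head (hq₁.trans hq₁')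
    (hQq' _ (List.mem_of_head? hq₁')) fun u w hu huw hw =>
      hQadj u w hu huw (ne_of_mem_of_not_mem hw v2q) (ne_of_mem_of_not_mem hw rtq)
        (ne_of_mem_of_not_mem hw v3q)
  have hPrₜ : ¬ P rₜ := fun h => (hPnot v₂ (hPadj _ _ h h2t.symm (Ne.symm n12)
    (ne_of_mem_of_not_mem hr₁m n2r).symm n24)).2.1 rfl
  have hQr₁ : ¬ Q r₁ := fun h => (hQnot v₁ (hQadj _ _ h hr1 n12
    (ne_of_mem_of_not_mem hrₜm n1r).symm n13)).2.1 rfl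
  have r1q : r₁ ∉ q := fun h => hQr₁ (hQq _ h)
  have hpq : ∀ w ∈ p, w ∉ q := fun w hwp hwq =>
    (hPnot _ ((isChain_of_cons_append hchq).getLast_of_mem (hqₗ.trans hqₗ') hwq (hPp w hwp)
      fun u x hu hux hx => hPadj u x hu hux (ne_of_mem_of_not_mem hx v1q)
        (ne_of_mem_of_not_mem hx r1q) (ne_of_mem_of_not_mem hx v4q))).2.2
      (List.mem_of_getLast? hqₗ')
  have hRr : r.reverse.IsChain G.Adj := by
    rw [List.isChain_reverse]
    exact hR.imp fun _ _ h => h.symm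
  have hhead : r.reverse.head? = some rₜ := by simpa using hrₜ
  have hlast : r.reverse.getLast? = some r₁ := by simpa using hr₁
  have hpr : ∀ w ∈ p, w ∉ r := fun w hwp hwr =>
    hPrₜ (hR.getLast_of_mem_ne_head ndr' hr₁ hrₜ hwr (ne_of_mem_of_not_mem hwp r1p) (hPp w hwp)
      fun u x hu hux hx hne => hPadj u x hu hux (ne_of_mem_of_not_mem hx n1r) hne
        (ne_of_mem_of_not_mem hx n4r)).2
  have hqr : ∀ w ∈ q, w ∉ r := fun w hwq hwr =>
    hQr₁ (hRr.getLast_of_mem_ne_head (List.nodup_reverse.2 ndr') hhead hlast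
      (List.mem_reverse.2 hwr) (ne_of_mem_of_not_mem hwq rtq) (hQq w hwq)
      fun u x hu hux hx hne => hQadj u x hu hux
        (ne_of_mem_of_not_mem (List.mem_reverse.1 hx) n2r) hne
        (ne_of_mem_of_not_mem (List.mem_reverse.1 hx) n3r)).2
  have hextL : ∀ w, D.IsExterior (G.deleteEdges EL) w →
      w = v₁ ∨ w = v₂ ∨ w ∈ q' ∨ w = v₃ ∨ w = v₄ ∨ w ∈ p := fun w h => by
    simpa using (hL.outer.isExterior_iff hleL w).1 h
  have hextR : ∀ w, D.IsExterior (G.deleteEdges ER) w →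
      w = v₁ ∨ w = v₂ ∨ w ∈ q ∨ w = v₃ ∨ w = v₄ ∨ w ∈ p' := fun w h => by
    simpa using (hRel.outer.isExterior_iff hleR w).1 h
  have hext : ∀ w ∈ [v₁, v₂] ++ q' ++ [v₃, v₄] ++ p'.reverse, D.IsExterior G w := fun w h =>
    (hout.isExterior_iff le_rfl w).2 h
  have hp'p : ∀ w ∈ p', w ∈ p := fun w hw => by
    simpa [ne_of_mem_of_not_mem hw n1p, ne_of_mem_of_not_mem hw n2p, ne_of_mem_of_not_mem hw n3p,
      ne_of_mem_of_not_mem hw n4p, show w ∉ q' from fun h => dpq w hw w (.inl h) rfl] using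
      hextL w ((hext w (by simp [hw])).mono hleL)
  have hq'q : ∀ w ∈ q', w ∈ q := fun w hw => by
    simpa [ne_of_mem_of_not_mem hw n1q, ne_of_mem_of_not_mem hw n2q, ne_of_mem_of_not_mem hw n3q,
      ne_of_mem_of_not_mem hw n4q, show w ∉ p' from fun h => dpq w h w (.inl hw) rfl] using
      hextR w ((hext w (by simp [hw])).mono hleR)
  have hall : ∀ w, w ∈ [v₁, v₂, v₃, v₄] ++ p ++ q ++ r := by
    intro w
    have h₁ := hp'p w
    have h₂ := hq'q w
    simp only [List.cons_append, List.nil_append, List.append_assoc, List.mem_cons,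
      List.mem_append]
    rcases D.mem_or_inside hnd4 (hrnot _ hr₁m) (hrnot _ hrₜm) hout hhex hCL'.2.2 hCR'.2.2 w
      with h | h | h | h
    · have h₃ : w = r₁ → w ∈ r := fun h => h ▸ hr₁m
      have h₄ : w = rₜ → w ∈ r := fun h => h ▸ hrₜm
      simp only [List.cons_append, List.nil_append, List.mem_cons, List.mem_append] at h
      clear * - h h₁ h₂ h₃ h₄
      tauto
    · have := hextL w (hL.released w h)
      clear * - this h₂
      tauto
    · have := hinR w h
      clear * - this
      tauto
    · have := hextR w (hRel.released w h)
      clear * - this h₁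
      tauto
  have hnd : ([v₁, v₂, v₃, v₄] ++ p ++ q ++ r).Nodup := by
    simp only [List.cons_append, List.nil_append, List.append_assoc, List.nodup_cons,
      List.mem_cons, List.mem_append, not_or, List.nodup_append]
    refine ⟨⟨n12, n13, n14, v1p, v1q, n1r⟩, ⟨n23, n24, v2p, v2q, n2r⟩, ⟨n34, v3p, v3q, n3r⟩,
      ⟨v4p, v4q, n4r⟩, ndp, ⟨ndq, ndr', fun a ha b hb h => hqr a ha (h ▸ hb)⟩, ?_⟩
    rintro a ha b (hb | hb) rfl
    exacts [hpq a ha hb, hpr a ha hb]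
  have hperm₁ : ([v₁, v₂, v₃, v₄] ++ p ++ q ++ r).Perm
      (v₁ :: v₂ :: (q ++ v₃ :: (r.reverse ++ v₄ :: p.reverse))) :=
    List.perm_iff_count.2 fun x => by
      simp only [List.count_append, List.count_cons, List.count_nil, List.count_reverse]; omega
  have hperm₂ : ([v₁, v₂, v₃, v₄] ++ p ++ q ++ r).Perm
      (v₁ :: (r ++ v₂ :: (q ++ v₃ :: v₄ :: p.reverse))) :=
    List.perm_iff_count.2 fun x => by
      simp only [List.count_append, List.count_cons, List.count_nil, List.count_reverse]; omega
  have hc₁ : IsCircle G (v₁ :: v₂ :: (q ++ v₃ :: (r.reverse ++ v₄ :: p.reverse))) := by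
    refine ⟨by simp; omega, hperm₁.nodup_iff.1 hnd, ?_⟩
    rw [isClosedWalk_cons]
    simp only [List.cons_append, List.append_assoc, List.isChain_cons_cons]
    refine ⟨h12, List.isChain_cons_split.2 ⟨hchq, ?_⟩⟩
    exact isChain_cons_append_of_ends hhead hlast hRr ht3.symm h4r.symm
      (isChain_cons_reverse_append.2 hchp)
  have hc₂ : IsCircle G (v₁ :: (r ++ v₂ :: (q ++ v₃ :: v₄ :: p.reverse))) := by
    refine ⟨by simp; omega, hperm₂.nodup_iff.1 hnd, ?_⟩
    rw [isClosedWalk_cons]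
    simp only [List.cons_append, List.append_assoc]
    refine isChain_cons_append_of_ends hr₁ hrₜ hR hr1.symm h2t.symm ?_
    exact List.isChain_cons_append_cons_cons.2 ⟨hchq, h34, isChain_cons_reverse_append.2 hchp⟩
  obtain ⟨H₁, hH₁, hs₁⟩ := hc₁.exists_isHamiltonianCycle fun w => hperm₁.mem_iff.1 (hall w)
  obtain ⟨H₂, hH₂, hs₂⟩ := hc₂.exists_isHamiltonianCycle fun w => hperm₂.mem_iff.1 (hall w)
  have hsign : walkSign σ H₁ / walkSign σ H₂ =
      cycSign σ ([v₃, v₄] ++ r) / cycSign σ ([v₁, v₂] ++ r.reverse) := by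
    rw [walkSign_eq, walkSign_eq, hs₁, hs₂]
    simp only [List.cons_append, List.nil_append, List.append_assoc, cycSign_cons]
    exact pathSign_div_pathSign σ v₁ v₂ v₃ v₄ r₁ rₜ p q r hr₁ hrₜ
  refine ⟨⟨H₁, H₂, hH₁, by simp [hs₁], hH₂, by simp [hs₂], hsign⟩, fun hne => ?_⟩
  have hne' : walkSign σ H₁ ≠ walkSign σ H₂ := fun h => by
    rw [h, div_self', eq_comm, div_eq_one] at hsign
    exact hne hsign.symm
  rcases Int.units_eq_one_or (walkSign σ H₁) with h₁ | h₁ <;>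
    rcases Int.units_eq_one_or (walkSign σ H₂) with h₂ | h₂
  · exact absurd (h₁.trans h₂.symm) hne'
  · exact ⟨⟨_, H₁, hH₁, h₁⟩, ⟨_, H₂, hH₂, h₂⟩⟩
  · exact ⟨⟨_, H₂, hH₂, h₂⟩, ⟨_, H₁, hH₁, h₁⟩⟩
  · exact absurd (h₁.trans h₂.symm) hne'
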